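/- \textbf{Definitions.} Let $G$ be a finite abelian group, written additively, with character group $\widehat G$. For $A\subset G$, $y\in G$ and $\chi\in\widehat G$ put $\nu_A(y)=|\{(a_1,a_2)\in A\times A: y=a_1-a_2\}|$ and $\chi(A)=\sum_{a\in A}\chi(a)$. Nonempty subsets $S,T\subset G$ form a \emph{formally dual pair} under an isomorphism $y\mapsto\chi_y$ from $G$ to $\widehat G$ if $|\chi_y(S)|^2=\frac{|S|^2}{|T|}\nu_T(y)$ for all $y\in G$. The pair is \emph{primitive} if neither $S$ nor $T$ is contained in a coset of a proper subgroup of $G$, and neither is a union of cosets of a nontrivial subgroup of $G$. Two sets $S,S'\subset G$ are \emph{equivalent} if $S'=g+\varphi(S)$ for some $g\in G$ and $\varphi\in\mathrm{Aut}(G)$; two pairs $S,T$ and $S',T'$ are \emph{equivalent} if one of $S,T$ is equivalent to one of $S',T'$. The \emph{difference spectrum} of $A$ is the multiset $[\nu_A(g): g\in G]$, its \emph{character spectrum} is the multiset $[|\chi(A)|^2:\chi\in\widehat G]$, and $\theta(A)$ is the multiplicity of $0$ in the difference spectrum of $A$. \textbf{The pairs.} For integers $m_1,m_2\ge 0$ with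 $m=m_1+m_2$, identify $\mathbb Z_4^{2m}=\mathbb Z_4^{2m_1}\times\mathbb Z_4^{2m_2}$ (the first $2m_1$ and the last $2m_2$ coordinates) and $\mathbb Z_4^{2m_2}=(\mathbb Z_4^2)^{m_2}$ (consecutive coordinates are paired). Let $P=\{0,1\}^{2m_1}\subset\mathbb Z_4^{2m_1}$; let $P_0$ (respectively $P_1$) be the set of $x\in P$ whose number of coordinates equal to $1$ is $\equiv 0,1$ (respectively $\equiv 2,3$) modulo $4$. Let $L_1=\{(0,0),(0,1),(1,0)\}$, $L_2=\{(3,3)\}$, $L=L_1\cup L_2\subset\mathbb Z_4^2$, and $Q=L^{m_2}\subset\mathbb Z_4^{2m_2}$; let $Q_0$ (respectively $Q_1$) be the set of $x\in Q$ for which the number of components lying in $L_1$ is congruent (respectively not congruent) to $m_2$ modulo $2$. Define subsets of $\mathbb Z_2\times\mathbb Z_4^{2m}$ by $$S'_{m_1}=\{0\}\times\big((P_0\times Q_0)\cup(P_1\times Q_1)\big)\ \cup\ \{1\}\times\big((P_0\times Q_1)\cup(P_1\times Q_0)\big),$$ $$T'_{m_1}=\{0\}\times(P\times Q)\ \cup\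 \{1\}\times\big((-P)\times(-Q)\big).$$ \textbf{Theorem.} Let $m\ge 2$. Then $\mathbb Z_2\times\mathbb Z_4^{2m}$ contains at least $m+1$ pairwise inequivalent primitive formally dual pairs in which the two subsets have unequal sizes. More precisely, under the isomorphism $(w,z)\mapsto\phi_{w,z}$, where $\phi_{w,z}(a,b)=(-1)^{wa}(\sqrt{-1})^{\sum_i z_ib_i}$, the following holds. (1) For every $0\le m_1\le m$, the sets $S'_{m_1}$ and $T'_{m_1}$ form a primitive formally dual pair, and $|S'_{m_1}|\ne|T'_{m_1}|$. (2) For $m_1\ne n_1$ in $\{0,\dots,m\}$, the pairs $S'_{m_1},T'_{m_1}$ and $S'_{n_1},T'_{n_1}$ are not equivalent. (3) The number $\theta(T'_{m_1})$ is strictly increasing in $m_1\in\{0,\dots,m\}$. In particular, the sets $T'_{m_1}$ have pairwise distinct difference spectra. (4) For every $0\le m_1\le m$, the multiplicity of $0$ in the character spectrum of $S'_{m_1}$ equals $\theta(T'_{m_1})$, and the sets $S'_{m_1}$ have pairwise distinct character spectra. -/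

import Mathlib

open scoped Pointwise

/-! ## Formally dual pairs in a finite abelian group (written additively) -/

/-- `ν_A(y)`: the number of pairs `(a₁, a₂) ∈ A × A` with `y = a₁ - a₂`. -/
def weightEnumerator {G : Type*} [AddCommGroup G] [DecidableEq G] (A : Finset G) (y : G) : ℕ :=
  ((A ×ˢ A).filter fun p => y = p.1 - p.2).card

/-- `S` and `T` form a formally dual pair in `G` under the isomorphism `Δ : G → Ĝ`, `y ↦ χ_y`:
`|χ_y(S)|² = (|S|² / |T|) ν_T(y)` for all `y`. The two sets are nonempty, as always in this
notion (otherwise the quotient, or the whole condition, is void). -/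
def IsFormallyDualPair {G : Type*} [AddCommGroup G] [DecidableEq G]
    (Δ : G ≃+ AddChar G ℂ) (S T : Finset G) : Prop :=
  S.Nonempty ∧ T.Nonempty ∧
    ∀ y : G, ‖∑ s ∈ S, Δ y s‖ ^ 2 = ((S.card : ℝ) ^ 2 / (T.card : ℝ)) * (weightEnumerator T y : ℝ)

/-- `S` is a primitive subset of `G`: it is not contained in a coset of a proper subgroup, and it
is not a union of cosets of a nontrivial subgroup. -/
def IsPrimitiveSubset {G : Type*} [AddCommGroup G] (S : Finset G) : Prop :=
  (¬ ∃ H : AddSubgroup G, H ≠ ⊤ ∧ ∃ g : G, (S : Set G) ⊆ g +ᵥ (H : Set G)) ∧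
  (¬ ∃ H : AddSubgroup G, H ≠ ⊥ ∧ ∃ A : Set G, (S : Set G) = ⋃ a ∈ A, a +ᵥ (H : Set G))

/-- A primitive formally dual pair: a formally dual pair of primitive subsets. -/
def IsPrimitiveFormallyDualPair {G : Type*} [AddCommGroup G] [DecidableEq G]
    (Δ : G ≃+ AddChar G ℂ) (S T : Finset G) : Prop :=
  IsFormallyDualPair Δ S T ∧ IsPrimitiveSubset S ∧ IsPrimitiveSubset T

/-- Equivalence of sets: `S' = g + φ(S)` for some `g ∈ G` and `φ ∈ Aut(G)`. -/
def SetEquivalent {G : Type*} [AddCommGroup G] [DecidableEq G] (S S' : Finset G) : Prop :=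
  ∃ (g : G) (φ : G ≃+ G), S' = S.image fun x => g + φ x

/-- Equivalence of the pairs `S, T` and `S', T'`: one of `S`, `T` is equivalent to one of
`S'`, `T'`. -/
def PairEquivalent {G : Type*} [AddCommGroup G] [DecidableEq G] (S T S' T' : Finset G) : Prop :=
  SetEquivalent S S' ∨ SetEquivalent S T' ∨ SetEquivalent T S' ∨ SetEquivalent T T'

/-- The difference spectrum of `A`: the multiset `[ν_A(g) | g ∈ G]`. -/
def differenceSpectrum {G : Type*} [AddCommGroup G] [DecidableEq G] [Fintype G] (A : Finset G) :
    Multiset ℕ :=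
  (Finset.univ : Finset G).val.map fun g => weightEnumerator A g

/-- `θ(A, G)`: the frequency of `0` in the difference spectrum of `A`. -/
def theta {G : Type*} [AddCommGroup G] [DecidableEq G] [Fintype G] (A : Finset G) : ℕ :=
  (differenceSpectrum A).count 0

open Classical in
/-- The character spectrum of `A`: the multiset `[|χ(A)|² | χ ∈ Ĝ]`. -/
noncomputable def characterSpectrum {G : Type*} [AddCommGroup G] [Fintype G] (A : Finset G) :
    Multiset ℝ :=
  (Finset.univ : Finset (AddChar G ℂ)).val.map fun χ => ‖∑ a ∈ A, χ a‖ ^ 2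

open Classical in
/-- The frequency of `0` in the character spectrum of `A`. -/
noncomputable def characterZeros {G : Type*} [AddCommGroup G] [Fintype G] (A : Finset G) : ℕ :=
  (characterSpectrum A).count 0

/-! ## The pairs in `ℤ₂ × ℤ₄^{2m}` -/

/-- The group `ℤ₂ × ℤ₄^{2m}`. -/
abbrev GroupZ (m : ℕ) : Type := ZMod 2 × (Fin (2 * m) → ZMod 4)

/-- `wt_j(x)`: the number of coordinates of `x` that equal `j`. -/
def wt {n : ℕ} (j : ZMod 4) (x : Fin n → ZMod 4) : ℕ :=
  (Finset.univ.filter fun i => x i = j).card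

/-- `J = {0, 1} ⊂ ℤ₄`. -/
def setJ : Finset (ZMod 4) := {0, 1}

/-- `∏_{j=1}^{2m} J ⊂ ℤ₄^{2m}`. -/
def powJ (m : ℕ) : Finset (Fin (2 * m) → ZMod 4) :=
  Finset.univ.filter fun x => ∀ i, x i ∈ setJ

/-- `B_{m,i}`, for `0 ≤ i ≤ 2m`. -/
def setB (m i : ℕ) : Finset (Fin (2 * m) → ZMod 4) :=
  Finset.univ.filter fun x => wt 0 x = 2 * m - i ∧ wt 1 x = i

/-- The part of `∏ J` made of the `B_{m,i}` with `i ≡ 0, 1 (mod 4)`. -/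
def partJ0 (m : ℕ) : Finset (Fin (2 * m) → ZMod 4) :=
  ((Finset.range (2 * m + 1)).filter fun i => i % 4 = 0 ∨ i % 4 = 1).biUnion (setB m)

/-- The part of `∏ J` made of the `B_{m,i}` with `i ≡ 2, 3 (mod 4)`. -/
def partJ1 (m : ℕ) : Finset (Fin (2 * m) → ZMod 4) :=
  ((Finset.range (2 * m + 1)).filter fun i => i % 4 = 2 ∨ i % 4 = 3).biUnion (setB m)

/-- `L₁ = {(0,0), (0,1), (1,0)} ⊂ ℤ₄²`. -/
def setL1 : Finset (ZMod 4 × ZMod 4) := {(0, 0), (0, 1), (1, 0)}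

/-- `L₂ = {(3,3)} ⊂ ℤ₄²`. -/
def setL2 : Finset (ZMod 4 × ZMod 4) := {(3, 3)}

/-- `L = {(0,0), (0,1), (1,0), (3,3)} ⊂ ℤ₄²`. -/
def setL : Finset (ZMod 4 × ZMod 4) := {(0, 0), (0, 1), (1, 0), (3, 3)}

/-- The `j`-th component of `x` under `ℤ₄^{2m} = (ℤ₄²)^m`: consecutive coordinates are paired. -/
def block {m : ℕ} (x : Fin (2 * m) → ZMod 4) (j : Fin m) : ZMod 4 × ZMod 4 :=
  (x ⟨2 * j.val, by omega⟩, x ⟨2 * j.val + 1, by omega⟩)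

/-- `∏_{j=1}^m L ⊂ ℤ₄^{2m}`. -/
def powL (m : ℕ) : Finset (Fin (2 * m) → ZMod 4) :=
  Finset.univ.filter fun x => ∀ j, block x j ∈ setL

/-- `E_{m,i}`: the union of the products `∏_{j=1}^m N_j` in which `i` of the factors `N_j` are `L₁`
and the other `m - i` are `L₂`. Such a product is coded by `c : Fin m → Bool`, with
`N_j = L₁` if and only if `c j = true`. -/
def setE (m i : ℕ) : Finset (Fin (2 * m) → ZMod 4) :=
  ((Finset.univ : Finset (Fin m → Bool)).filter fun c =>
      (Finset.univ.filter fun j => c j = true).card = i).biUnion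
    fun c => Finset.univ.filter fun x => ∀ j, block x j ∈ (if c j = true then setL1 else setL2)

/-- The part of `∏ L` made of the `E_{m,i}`, `0 ≤ i ≤ m`, with `i ≡ m (mod 2)`. -/
def partL0 (m : ℕ) : Finset (Fin (2 * m) → ZMod 4) :=
  ((Finset.range (m + 1)).filter fun i => i % 2 = m % 2).biUnion (setE m)

/-- The part of `∏ L` made of the `E_{m,i}`, `0 ≤ i ≤ m`, with `i ≢ m (mod 2)`. -/
def partL1 (m : ℕ) : Finset (Fin (2 * m) → ZMod 4) :=
  ((Finset.range (m + 1)).filter fun i => i % 2 ≠ m % 2).biUnion (setE m)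

/-- The first component of `x` under `ℤ₄^{2m} = ℤ₄^{2m₁} × ℤ₄^{2m₂}`. -/
def leftPart {m m₁ m₂ : ℕ} (h : m₁ + m₂ = m) (x : Fin (2 * m) → ZMod 4) :
    Fin (2 * m₁) → ZMod 4 :=
  fun i => x ⟨i.val, by omega⟩

/-- The second component of `x` under `ℤ₄^{2m} = ℤ₄^{2m₁} × ℤ₄^{2m₂}`. -/
def rightPart {m m₁ m₂ : ℕ} (h : m₁ + m₂ = m) (x : Fin (2 * m) → ZMod 4) :
    Fin (2 * m₂) → ZMod 4 :=
  fun i => x ⟨2 * m₁ + i.val, by omega⟩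

/-- The product `A × B ⊂ ℤ₄^{2m}` of `A ⊂ ℤ₄^{2m₁}` and `B ⊂ ℤ₄^{2m₂}`. -/
def prodSet {m m₁ m₂ : ℕ} (h : m₁ + m₂ = m) (A : Finset (Fin (2 * m₁) → ZMod 4))
    (B : Finset (Fin (2 * m₂) → ZMod 4)) : Finset (Fin (2 * m) → ZMod 4) :=
  Finset.univ.filter fun x => leftPart h x ∈ A ∧ rightPart h x ∈ B

/-- `({0} × A) ∪ ({1} × B) ⊂ ℤ₂ × ℤ₄^{2m}`. -/
def liftSet {m : ℕ} (A B : Finset (Fin (2 * m) → ZMod 4)) : Finset (GroupZ m) :=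
  A.image (fun x => ((0 : ZMod 2), x)) ∪ B.image (fun x => ((1 : ZMod 2), x))

/-- The set `S'` of the pair belonging to the splitting `m = m₁ + m₂`. -/
def mixS {m m₁ m₂ : ℕ} (h : m₁ + m₂ = m) : Finset (GroupZ m) :=
  liftSet
    (prodSet h (partJ0 m₁) (partL0 m₂) ∪ prodSet h (partJ1 m₁) (partL1 m₂))
    (prodSet h (partJ0 m₁) (partL1 m₂) ∪ prodSet h (partJ1 m₁) (partL0 m₂))

/-- The set `T'` of the pair belonging to the splitting `m = m₁ + m₂`. -/
def mixT {m m₁ m₂ : ℕ} (h : m₁ + m₂ = m) : Finset (GroupZ m) :=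
  liftSet (prodSet h (powJ m₁) (powL m₂)) (prodSet h (-powJ m₁) (-powL m₂))

/-!
The group `ℤ₄^{2m}` is viewed as `(ℤ₄²)^m`, and the splitting `m = m₁ + m₂` becomes a choice, for
each of the `m` blocks, of one of two four-element sets `D_j ⊂ ℤ₄²`: the square `J × J` for the
first `m₁` blocks and `L` for the others. With `X = ∏ D_j`, the set `T'` is `{0} × X ∪ {1} × -X`.
The set `S'` is the graph over `X` of a function to `ℤ₂`. To find this function, give a point of
`J × J` as phase the sum of its coordinates, and give the points of `L` the phase `0`, except
`(3,3)`, which gets the phase `2`. Then the function is `0` or `1` according as the total phase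
`W(x) ∈ ℤ₄` lies in `{0, 1}` or in `{2, 3}` (`mixS_eq`, `mixT_eq`).

The sign attached to `x` is therefore the real part of `(1 - i) i^{W(x)}`, so that every character
sum over `S'` is a combination of at most two products over the blocks: at `(0, z)` it is the
product of the Fourier transforms of the `D_j`, and at `(1, z)` it is `((1 - i) A + (1 + i) B) /
2` with `A = ∏ A_j` and `B = ∏ B_j` the sums twisted by `i^W` and `i^{-W}`. In each block, the
squared moduli of these sums are four times the number of representations of `z_j` as a
difference, and of `-z_j` and `z_j` as a sum, of two elements of `D_j`; moreover each `A_j B̄_j`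
is real, which makes the cross terms vanish. These finitely many identities are checked in the
Gaussian integers. Since `ν_{T'}(0, z)` and `ν_{T'}(1, z)` are built from the same products,
formal duality follows (`isFormallyDualPair_phaseGraph_doubled`).

Both sets are primitive because they contain `0`, the unit vectors and an element with first
coordinate `1`, and because they have no nonzero period: for a period `(0, z)` of either set, or
`(1, z)` of `S'`, each block of `z` is a period of `D_j` and vanishes; `(1, 0)` is not a period of
the graph `S'`; and a period `(1, z)` of `T'` would exchange `D_j` and `-D_j` in each block, which
is impossible.

Inclusion and exclusion gives the number of nonzero values of `ν_{T'}` as `9^{m₁} 13^{m₂} + 2 ·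
9^{m₁} 10^{m₂} - 4^{m₁} 10^{m₂}`, which is strictly decreasing in `m₁` when `m ≥ 2`
(`theta_splitKind`, `theta_splitKind_lt`). Duality carries the zeros of `ν_{T'}` to the zeros of
the character spectrum of `S'`. Both spectra are invariant under equivalence, and `|S'| = 4^m ≠ 2
· 4^m = |T'|` excludes an equivalence between an `S'` and a `T'`.
-/

/-! ### Characters of `ℤ₂ × ℤ₄^{2m}` -/

/-- The character `a ↦ iᵃ` of `ℤ₄`. -/
noncomputable def quarticChar : AddChar (ZMod 4) ℂ where
  toFun a := Complex.I ^ a.val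
  map_zero_eq_one' := by simp
  map_add_eq_mul' a b := by
    rw [ZMod.val_add, ← pow_add, ← Complex.I_pow_eq_pow_mod]

lemma quarticChar_apply (a : ZMod 4) : quarticChar a = Complex.I ^ a.val := rfl

/-- The character `a ↦ (-1)ᵃ` of `ℤ₂`. -/
noncomputable def signChar : AddChar (ZMod 2) ℂ where
  toFun a := (-1) ^ a.val
  map_zero_eq_one' := by simp
  map_add_eq_mul' a b := by
    rw [ZMod.val_add, ← pow_add, ← neg_one_pow_eq_pow_mod_two]

lemma signChar_apply (a : ZMod 2) : signChar a = (-1) ^ a.val := rfl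

lemma quarticChar_eq_one {a : ZMod 4} (h : quarticChar a = 1) : a = 0 := by
  rw [quarticChar_apply] at h
  fin_cases a
  · rfl
  · simp [ZMod.val, Complex.ext_iff] at h
  · simp [ZMod.val, Complex.ext_iff] at h
    norm_num at h
  · simp [ZMod.val, Complex.ext_iff] at h

lemma signChar_eq_one {a : ZMod 2} (h : signChar a = 1) : a = 0 := by
  rw [signChar_apply] at h
  fin_cases a
  · rfl
  · simp [ZMod.val] at h
    norm_num at h

/-- The homomorphism `(w, z) ↦ φ_{w,z}`. -/
noncomputable def dualHom (m : ℕ) : GroupZ m →+ AddChar (GroupZ m) ℂ :=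
  AddMonoidHom.mk' (fun y =>
    { toFun := fun g => signChar (y.1 * g.1) * quarticChar (∑ i, y.2 i * g.2 i)
      map_zero_eq_one' := by simp
      map_add_eq_mul' := fun a b => by
        simp only [Prod.fst_add, Prod.snd_add, Pi.add_apply, mul_add, Finset.sum_add_distrib,
          AddChar.map_add_eq_mul]
        ring })
    fun y y' => by
      ext g
      simp only [Prod.fst_add, Prod.snd_add, Pi.add_apply, add_mul, Finset.sum_add_distrib,
        AddChar.map_add_eq_mul, AddChar.add_apply, AddChar.coe_mk]
      ring

lemma dualHom_apply {m : ℕ} (y g : GroupZ m) :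
    dualHom m y g = signChar (y.1 * g.1) * quarticChar (∑ i, y.2 i * g.2 i) := rfl

lemma dualHom_injective (m : ℕ) : Function.Injective (dualHom m) := by
  rw [injective_iff_map_eq_zero]
  intro y hy
  have key : ∀ g : GroupZ m, signChar (y.1 * g.1) * quarticChar (∑ i, y.2 i * g.2 i) = 1 := by
    intro g
    rw [← dualHom_apply, hy]; rfl
  refine Prod.ext ?_ (funext fun i => ?_)
  · exact signChar_eq_one (by simpa using key (1, 0))
  · exact quarticChar_eq_one (by simpa [Pi.single_apply] using key (0, Pi.single i 1))

/-- The isomorphism `(w, z) ↦ φ_{w,z}`: it is injective between finite groups of equal order. -/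
noncomputable def dualEquiv (m : ℕ) : GroupZ m ≃+ AddChar (GroupZ m) ℂ :=
  AddEquiv.ofBijective (dualHom m)
    ((Fintype.bijective_iff_injective_and_card _).2 ⟨dualHom_injective m, AddChar.card_eq.symm⟩)

lemma dualEquiv_apply {m : ℕ} (y g : GroupZ m) :
    dualEquiv m y g = signChar (y.1 * g.1) * quarticChar (∑ i, y.2 i * g.2 i) := rfl

/-! ### Equivalence, spectra and primitivity in a finite abelian group -/

section General

variable {G : Type*} [AddCommGroup G]

/-- A subset containing `0` is primitive if it generates the group and no nonzero translation
maps it into itself. -/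
lemma isPrimitiveSubset_of {S : Finset G} (h0 : (0 : G) ∈ S)
    (hgen : ∀ H : AddSubgroup G, (∀ s ∈ S, s ∈ H) → H = ⊤)
    (hper : ∀ h : G, (∀ s ∈ S, h + s ∈ S) → h = 0) : IsPrimitiveSubset S := by
  constructor
  · rintro ⟨H, hH, g, hg⟩
    refine hH (hgen H fun s hs => ?_)
    have h1 := hg (Finset.mem_coe.2 h0)
    have h2 := hg (Finset.mem_coe.2 hs)
    rw [Set.mem_vadd_set_iff_neg_vadd_mem] at h1 h2
    simp only [vadd_eq_add, add_zero, SetLike.mem_coe] at h1 h2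
    exact (H.add_mem_cancel_left h1).1 h2
  · rintro ⟨H, hH, A, hA⟩
    refine hH ((AddSubgroup.eq_bot_iff_forall _).2 fun h hh => hper h fun s hs => ?_)
    rw [← Finset.mem_coe, hA] at hs ⊢
    simp only [Set.mem_iUnion, Set.mem_vadd_set_iff_neg_vadd_mem, vadd_eq_add, SetLike.mem_coe,
      exists_prop] at hs ⊢
    obtain ⟨a, ha, hs⟩ := hs
    refine ⟨a, ha, ?_⟩
    rw [add_left_comm]
    exact H.add_mem hh hs

variable [DecidableEq G]

lemma weightEnumerator_eq_card (A : Finset G) (y : G) :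
    weightEnumerator A y = (A.filter fun a => y + a ∈ A).card := by
  refine Finset.card_bij' (fun p _ => p.2) (fun a _ => (y + a, a)) ?_ ?_ ?_ ?_
  · rintro ⟨a, b⟩ h
    simp only [Finset.mem_filter, Finset.mem_product] at h ⊢
    rw [h.2, sub_add_cancel]
    exact ⟨h.1.2, h.1.1⟩
  · intro a h
    simp only [Finset.mem_filter, Finset.mem_product] at h ⊢
    exact ⟨⟨h.2, h.1⟩, by abel⟩
  · rintro ⟨a, b⟩ h
    simp only [Finset.mem_filter] at h
    simp [h.2]
  · intro a h
    rfl

lemma SetEquivalent.card_eq {S S' : Finset G} (h : SetEquivalent S S') : S'.card = S.card := by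
  obtain ⟨g, φ, rfl⟩ := h
  exact Finset.card_image_of_injective _ ((add_right_injective g).comp φ.injective)

lemma SetEquivalent.differenceSpectrum_eq [Fintype G] {S S' : Finset G}
    (h : SetEquivalent S S') : differenceSpectrum S' = differenceSpectrum S := by
  obtain ⟨g, φ, rfl⟩ := h
  have hinj : Function.Injective fun x => g + φ x := (add_right_injective g).comp φ.injective
  have key : ∀ y, weightEnumerator (S.image fun x => g + φ x) (φ y) = weightEnumerator S y := by
    intro y
    rw [weightEnumerator_eq_card, weightEnumerator_eq_card, Finset.filter_image,
      Finset.card_image_of_injective _ hinj]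
    congr 1
    refine Finset.filter_congr fun a _ => ?_
    rw [← hinj.mem_finset_image (s := S) (a := y + a)]
    simp only [map_add]
    rw [add_left_comm]
  unfold differenceSpectrum
  conv_lhs => rw [← Multiset.map_univ_val_equiv φ.toEquiv, Multiset.map_map]
  exact Multiset.map_congr rfl fun y _ => key y

lemma SetEquivalent.characterSpectrum_eq [Fintype G] {S S' : Finset G}
    (h : SetEquivalent S S') : characterSpectrum S' = characterSpectrum S := by
  classical
  obtain ⟨g, φ, rfl⟩ := h
  let e : AddChar G ℂ ≃ AddChar G ℂ :=
    { toFun := fun χ => χ.compAddMonoidHom φ.toAddMonoidHom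
      invFun := fun χ => χ.compAddMonoidHom φ.symm.toAddMonoidHom
      left_inv := fun χ => by ext; simp
      right_inv := fun χ => by ext; simp }
  have hinj : Function.Injective fun x => g + φ x := (add_right_injective g).comp φ.injective
  unfold characterSpectrum
  conv_rhs => rw [← Multiset.map_univ_val_equiv e, Multiset.map_map]
  refine Multiset.map_congr rfl fun χ _ => ?_
  rw [Finset.sum_image hinj.injOn]
  simp only [AddChar.map_add_eq_mul, ← Finset.mul_sum, norm_mul, AddChar.norm_apply, one_mul]
  rfl

lemma theta_eq_card [Fintype G] (A : Finset G) :
    theta A = (Finset.univ.filter fun y => weightEnumerator A y = 0).card := by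
  unfold theta differenceSpectrum
  rw [Multiset.count_map]
  simp only [eq_comm]
  rfl

/-- For a formally dual pair, the difference spectrum of `T` and the character spectrum of `S`
have equally many zeros. -/
lemma IsFormallyDualPair.characterZeros_eq_theta [Fintype G] {Δ : G ≃+ AddChar G ℂ}
    {S T : Finset G} (h : IsFormallyDualPair Δ S T) : characterZeros S = theta T := by
  classical
  obtain ⟨hS, hT, h⟩ := h
  have hc : ((S.card : ℝ) ^ 2 / (T.card : ℝ)) ≠ 0 := by
    have := hS.card_pos
    have := hT.card_pos
    positivity
  unfold characterZeros characterSpectrum theta differenceSpectrum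
  rw [← Multiset.map_univ_val_equiv Δ.toEquiv, Multiset.map_map, Multiset.count_map,
    Multiset.count_map]
  congr 1
  refine Multiset.filter_congr fun y _ => ?_
  have := h y
  simp only [Function.comp_apply, AddEquiv.toEquiv_eq_coe, AddEquiv.coe_toEquiv]
  rw [this, eq_comm, mul_eq_zero, or_iff_right hc, Nat.cast_eq_zero, eq_comm]

end General

/-! ### Cells: the sets `J × J` and `L` in `ℤ₄²` -/

/-- The set `J × J` (for `true`) or `L` (for `false`) in `ℤ₄²`. -/
def cellSet (b : Bool) : Finset (ZMod 4 × ZMod 4) := if b then setJ ×ˢ setJ else setL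

/-- The phase of a point of `cellSet b`: the sum of the coordinates on `J × J`, and on `L` the
value `2` at `(3,3)` and `0` elsewhere. The sign of a point of `P × Q` in `S'` depends only on the
sum of the phases of its components. -/
def cellPhase (b : Bool) (d : ZMod 4 × ZMod 4) : ZMod 4 :=
  if b then d.1 + d.2 else if d = (3, 3) then 2 else 0

/-- The sum `∑_{d ∈ D} i^{cw(d) + z·d}` over `D = cellSet b`, with `w` the phase, as a Gaussian
integer. -/
def cellSum (b : Bool) (c : ZMod 4) (z : ZMod 4 × ZMod 4) : GaussianInt :=
  ∑ d ∈ cellSet b, (⟨0, 1⟩ : GaussianInt) ^ (c * cellPhase b d + (z.1 * d.1 + z.2 * d.2)).val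

lemma cellSum_coe (b : Bool) (c : ZMod 4) (z : ZMod 4 × ZMod 4) :
    (cellSum b c z : ℂ) =
      ∑ d ∈ cellSet b, quarticChar (c * cellPhase b d + (z.1 * d.1 + z.2 * d.2)) := by
  have hI : ((⟨0, 1⟩ : GaussianInt) : ℂ) = Complex.I := by
    simp [GaussianInt.toComplex_def]
  simp only [cellSum, map_sum, map_pow, quarticChar_apply, hI]

/-- The number of `d ∈ D` with `z + d ∈ D`, for `D = cellSet b`. -/
def cellDiff (b : Bool) (z : ZMod 4 × ZMod 4) : ℕ :=
  ((cellSet b).filter fun d => z + d ∈ cellSet b).card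

/-- The number of `d ∈ D` with `z - d ∈ D`, for `D = cellSet b`. -/
def cellAdd (b : Bool) (z : ZMod 4 × ZMod 4) : ℕ :=
  ((cellSet b).filter fun d => z - d ∈ cellSet b).card

lemma card_cellSet (b : Bool) : (cellSet b).card = 4 := by
  revert b; decide +kernel

lemma cellDiff_eq (b : Bool) (z : ZMod 4 × ZMod 4) :
    ((cellSet b).filter fun d => d - z ∈ cellSet b).card = cellDiff b z := by
  revert b z; decide +kernel

lemma norm_cellSum_zero (b : Bool) (z : ZMod 4 × ZMod 4) :
    (cellSum b 0 z).norm = 4 * cellDiff b z := by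
  revert b z; decide +kernel

lemma norm_cellSum_one (b : Bool) (z : ZMod 4 × ZMod 4) :
    (cellSum b 1 z).norm = 4 * cellAdd b (-z) := by
  revert b z; decide +kernel

lemma norm_cellSum_neg_one (b : Bool) (z : ZMod 4 × ZMod 4) :
    (cellSum b (-1) z).norm = 4 * cellAdd b z := by
  revert b z; decide +kernel

lemma cellSum_mul_star_im (b : Bool) (z : ZMod 4 × ZMod 4) :
    (cellSum b 1 z * star (cellSum b (-1) z)).im = 0 := by
  revert b z; decide +kernel

lemma card_cellDiff_ne_zero (b : Bool) :
    (Finset.univ.filter fun z => cellDiff b z ≠ 0).card = if b then 9 else 13 := by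
  revert b; decide +kernel

lemma card_cellAdd_ne_zero (b : Bool) :
    (Finset.univ.filter fun z => cellAdd b z ≠ 0).card = if b then 9 else 10 := by
  revert b; decide +kernel

lemma card_cellAdd_neg_ne_zero (b : Bool) :
    (Finset.univ.filter fun z => cellAdd b (-z) ≠ 0).card = if b then 9 else 10 := by
  revert b; decide +kernel

lemma card_cellAdd_both_ne_zero (b : Bool) :
    (Finset.univ.filter fun z => cellAdd b z ≠ 0 ∧ cellAdd b (-z) ≠ 0).card =
      if b then 4 else 10 := by
  revert b; decide +kernel

lemma cellSet_no_period (b : Bool) (z : ZMod 4 × ZMod 4)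
    (h : ∀ d ∈ cellSet b, z + d ∈ cellSet b) : z = 0 := by
  revert b z; decide +kernel

lemma cellSet_no_swap (b : Bool) (z : ZMod 4 × ZMod 4)
    (h₁ : ∀ d ∈ cellSet b, -(z + d) ∈ cellSet b) : ∃ d ∈ cellSet b, z - d ∉ cellSet b := by
  revert b z; decide +kernel

lemma zero_mem_cellSet (b : Bool) : 0 ∈ cellSet b := by
  revert b; decide +kernel

lemma cellPhase_zero (b : Bool) : cellPhase b 0 = 0 := by
  revert b; decide +kernel

/-- The value in `ℤ₂` attached to a total phase in `ℤ₄`. -/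
def phaseClass (a : ZMod 4) : ZMod 2 := if a = 0 ∨ a = 1 then 0 else 1

/-- The sign `+, +, -, -` of a phase `0, 1, 2, 3` is the real part of `(1 - i) iᵃ`. -/
lemma signChar_phaseClass (a : ZMod 4) :
    signChar (phaseClass a) =
      ((1 - Complex.I) * quarticChar a + (1 + Complex.I) * quarticChar (-a)) / 2 := by
  have h3 : Complex.I ^ 3 = -Complex.I := Complex.I_pow_three
  have hc : phaseClass 0 = 0 ∧ phaseClass 1 = 0 ∧ phaseClass 2 = 1 ∧ phaseClass 3 = 1 := by decide
  obtain ⟨c0, c1, c2, c3⟩ := hc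
  have v : (0 : ZMod 4).val = 0 ∧ (1 : ZMod 4).val = 1 ∧ (2 : ZMod 4).val = 2 ∧
    (3 : ZMod 4).val = 3 ∧ (1 : ZMod 2).val = 1 := by decide
  obtain ⟨v0, v1, v2, v3, w1⟩ := v
  have n : (-0 : ZMod 4) = 0 ∧ (-1 : ZMod 4) = 3 ∧ (-2 : ZMod 4) = 2 ∧ (-3 : ZMod 4) = 1 := by
    decide
  obtain ⟨n0, n1, n2, n3⟩ := n
  have ha : a = 0 ∨ a = 1 ∨ a = 2 ∨ a = 3 := by revert a; decide
  rcases ha with rfl | rfl | rfl | rfl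
  · rw [n0, c0]; simp
  · rw [n1, c1, quarticChar_apply, quarticChar_apply, v1, v3, h3]; simp
    linear_combination Complex.I_mul_I
  · rw [n2, c2, quarticChar_apply, signChar_apply, v2, w1, Complex.I_sq]; ring
  · rw [n3, c3, quarticChar_apply, quarticChar_apply, signChar_apply, v1, v3, w1, h3]
    linear_combination -Complex.I_mul_I

/-! ### Block decomposition of `ℤ₄^{2m}` -/

lemma sum_coord_eq_sum_pairs {M : Type*} [AddCommMonoid M] {m : ℕ} (f : Fin (2 * m) → M) :
    ∑ i, f i = ∑ j : Fin m, (f ⟨2 * j.val, by omega⟩ + f ⟨2 * j.val + 1, by omega⟩) := by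
  rw [← Equiv.sum_comp (finProdFinEquiv.trans (finCongr (mul_comm m 2))), Fintype.sum_prod_type]
  refine Finset.sum_congr rfl fun j _ => ?_
  rw [Fin.sum_univ_two]
  congr 2 <;> ext <;> simp [finProdFinEquiv, add_comm]

lemma forall_coord_iff_forall_pairs {m : ℕ} (p : Fin (2 * m) → Prop) :
    (∀ i, p i) ↔ ∀ j : Fin m, p ⟨2 * j.val, by omega⟩ ∧ p ⟨2 * j.val + 1, by omega⟩ := by
  refine ⟨fun h j => ⟨h _, h _⟩, fun h i => ?_⟩
  rcases Nat.even_or_odd' i.val with ⟨c, hc | hc⟩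
  · have := (h ⟨c, by omega⟩).1
    rwa [show i = ⟨2 * c, by omega⟩ from Fin.ext hc]
  · have := (h ⟨c, by omega⟩).2
    rwa [show i = ⟨2 * c + 1, by omega⟩ from Fin.ext hc]

/-- The isomorphism `ℤ₄^{2m} = (ℤ₄²)^m` pairing consecutive coordinates. -/
def blockEquiv (m : ℕ) : (Fin (2 * m) → ZMod 4) ≃+ (Fin m → ZMod 4 × ZMod 4) where
  toFun x j := block x j
  invFun f i := if i.val % 2 = 0 then (f ⟨i.val / 2, by omega⟩).1 else (f ⟨i.val / 2, by omega⟩).2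
  left_inv x := by
    refine funext fun i => ?_
    dsimp only [block]
    split_ifs with h <;> congr 1 <;> ext <;> dsimp only <;> omega
  right_inv f := by
    refine funext fun j => ?_
    have h : (2 * j.val + 1) / 2 = j.val := by omega
    simp [block, h]
  map_add' x y := rfl

lemma block_blockEquiv_symm {m : ℕ} (f : Fin m → ZMod 4 × ZMod 4) (j : Fin m) :
    block ((blockEquiv m).symm f) j = f j :=
  congrFun ((blockEquiv m).apply_symm_apply f) j

lemma block_add {m : ℕ} (x y : Fin (2 * m) → ZMod 4) (j : Fin m) :
    block (x + y) j = block x j + block y j := rfl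

lemma block_sub {m : ℕ} (x y : Fin (2 * m) → ZMod 4) (j : Fin m) :
    block (x - y) j = block x j - block y j := rfl

lemma block_neg {m : ℕ} (x : Fin (2 * m) → ZMod 4) (j : Fin m) :
    block (-x) j = -block x j := rfl

lemma block_zero {m : ℕ} (j : Fin m) : block (0 : Fin (2 * m) → ZMod 4) j = 0 := rfl

lemma eq_zero_of_block {m : ℕ} {x : Fin (2 * m) → ZMod 4} (h : ∀ j, block x j = 0) : x = 0 :=
  (blockEquiv m).injective (funext h)

/-- A sum of a product of block functions over a product of subsets of `ℤ₄²` factors. -/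
lemma sum_prod_block {R : Type*} [CommSemiring R] {m : ℕ} (D : Fin m → Finset (ZMod 4 × ZMod 4))
    (f : Fin m → ZMod 4 × ZMod 4 → R) :
    ∑ x : Fin (2 * m) → ZMod 4 with ∀ j, block x j ∈ D j, ∏ j, f j (block x j) =
      ∏ j, ∑ d ∈ D j, f j d := by
  rw [Finset.prod_univ_sum]
  refine Finset.sum_equiv (blockEquiv m).toEquiv (fun x => ?_) fun x _ => rfl
  rw [Finset.mem_filter_univ, Fintype.mem_piFinset]
  rfl

lemma card_block_mem {m : ℕ} (D : Fin m → Finset (ZMod 4 × ZMod 4)) :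
    (Finset.univ.filter fun x : Fin (2 * m) → ZMod 4 => ∀ j, block x j ∈ D j).card =
      ∏ j, (D j).card := by
  have := sum_prod_block D fun _ _ => 1
  simpa using this

lemma dot_eq_sum_block {m : ℕ} (z x : Fin (2 * m) → ZMod 4) :
    ∑ i, z i * x i =
      ∑ j, ((block z j).1 * (block x j).1 + (block z j).2 * (block x j).2) :=
  sum_coord_eq_sum_pairs _

/-! ### Sets with a prescribed sequence of cells -/

section CellProducts

variable {m : ℕ} (κ : Fin m → Bool)

/-- The product of the cells `J × J` (where `κ j` is `true`) and `L` (where it is `false`). -/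
def cellProd : Finset (Fin (2 * m) → ZMod 4) :=
  Finset.univ.filter fun x => ∀ j, block x j ∈ cellSet (κ j)

/-- The sum of the phases of the components of `x`. -/
def totalPhase (x : Fin (2 * m) → ZMod 4) : ZMod 4 := ∑ j, cellPhase (κ j) (block x j)

/-- The graph over `cellProd κ` of the function sending a point to the class of its phase. -/
def phaseGraph : Finset (GroupZ m) := (cellProd κ).image fun x => (phaseClass (totalPhase κ x), x)

/-- The set `({0} × X) ∪ ({1} × -X)` with `X = cellProd κ`. -/
def doubled : Finset (GroupZ m) := liftSet (cellProd κ) (-cellProd κ)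

variable {κ}

lemma mem_cellProd {x : Fin (2 * m) → ZMod 4} :
    x ∈ cellProd κ ↔ ∀ j, block x j ∈ cellSet (κ j) := Finset.mem_filter_univ _

lemma card_cellProd : (cellProd κ).card = 4 ^ m := by
  rw [cellProd, card_block_mem]
  simp [card_cellSet]

lemma mem_phaseGraph {g : GroupZ m} :
    g ∈ phaseGraph κ ↔ g.2 ∈ cellProd κ ∧ g.1 = phaseClass (totalPhase κ g.2) := by
  obtain ⟨a, x⟩ := g
  simp only [phaseGraph, Finset.mem_image, Prod.mk.injEq]
  constructor
  · rintro ⟨y, hy, h, rfl⟩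
    exact ⟨hy, h.symm⟩
  · rintro ⟨hx, h⟩
    exact ⟨x, hx, h.symm, rfl⟩

lemma zero_mk_mem_doubled {x : Fin (2 * m) → ZMod 4} :
    ((0 : ZMod 2), x) ∈ doubled κ ↔ x ∈ cellProd κ := by
  simp [doubled, liftSet]

lemma one_mk_mem_doubled {x : Fin (2 * m) → ZMod 4} :
    ((1 : ZMod 2), x) ∈ doubled κ ↔ -x ∈ cellProd κ := by
  simp [doubled, liftSet]

lemma sum_doubled {M : Type*} [AddCommMonoid M] (f : GroupZ m → M) :
    ∑ g ∈ doubled κ, f g = ∑ x ∈ cellProd κ, f (0, x) + ∑ x ∈ cellProd κ, f (1, -x) := by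
  have h1 (a : ZMod 2) : Function.Injective fun x : Fin (2 * m) → ZMod 4 => (a, x) :=
    Prod.mk_right_injective a
  rw [doubled, liftSet, Finset.sum_union, Finset.sum_image (h1 0).injOn,
    Finset.sum_image (h1 1).injOn]
  · congr 1
    refine Finset.sum_nbij' (fun x => -x) (fun x => -x) ?_ ?_ ?_ ?_ ?_ <;> simp
  · rw [Finset.disjoint_left]
    simp

lemma card_doubled : (doubled κ).card = 2 * 4 ^ m := by
  rw [Finset.card_eq_sum_ones, sum_doubled]
  simp [card_cellProd, two_mul]

lemma sum_phaseGraph {M : Type*} [AddCommMonoid M] (f : GroupZ m → M) :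
    ∑ g ∈ phaseGraph κ, f g = ∑ x ∈ cellProd κ, f (phaseClass (totalPhase κ x), x) :=
  Finset.sum_image (Function.Injective.injOn fun _ _ h => congrArg Prod.snd h)

lemma card_phaseGraph : (phaseGraph κ).card = 4 ^ m := by
  rw [Finset.card_eq_sum_ones, sum_phaseGraph]
  simp [card_cellProd]

/-! ### Formal duality -/

lemma card_cellProd_filter (q : (Fin (2 * m) → ZMod 4) → Fin (2 * m) → ZMod 4)
    (r : Fin m → ZMod 4 × ZMod 4 → ZMod 4 × ZMod 4)
    (h : ∀ x j, block (q x) j = r j (block x j)) :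
    ((cellProd κ).filter fun x => q x ∈ cellProd κ).card =
      ∏ j, ((cellSet (κ j)).filter fun d => r j d ∈ cellSet (κ j)).card := by
  rw [← card_block_mem, cellProd, Finset.filter_filter]
  congr 1
  refine Finset.filter_congr fun x _ => ?_
  simp only [Finset.mem_filter, h, Finset.mem_univ, true_and, forall_and]

lemma weightEnumerator_doubled_zero (z : Fin (2 * m) → ZMod 4) :
    weightEnumerator (doubled κ) (0, z) = 2 * ∏ j, cellDiff (κ j) (block z j) := by
  rw [weightEnumerator_eq_card, Finset.card_filter, sum_doubled]
  simp only [Prod.mk_add_mk, add_zero, zero_add, zero_mk_mem_doubled, one_mk_mem_doubled,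
    ← Finset.card_filter]
  rw [card_cellProd_filter (fun x => z + x) (fun j d => block z j + d) fun x j => rfl,
    card_cellProd_filter (fun x => -(z + -x)) (fun j d => d - block z j) fun x j => by
      rw [block_neg, block_add, block_neg]; abel, two_mul]
  simp only [cellDiff_eq]
  rfl

lemma weightEnumerator_doubled_one (z : Fin (2 * m) → ZMod 4) :
    weightEnumerator (doubled κ) (1, z) =
      ∏ j, cellAdd (κ j) (-block z j) + ∏ j, cellAdd (κ j) (block z j) := by
  have h2 : (1 + 1 : ZMod 2) = 0 := rfl
  rw [weightEnumerator_eq_card, Finset.card_filter, sum_doubled]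
  simp only [Prod.mk_add_mk, add_zero, h2, zero_mk_mem_doubled, one_mk_mem_doubled,
    ← Finset.card_filter]
  rw [card_cellProd_filter (fun x => -(z + x)) (fun j d => -block z j - d) fun x j => by
      rw [block_neg, block_add]; abel,
    card_cellProd_filter (fun x => z + -x) (fun j d => block z j - d) fun x j => by
      rw [block_add, block_neg]; abel]
  rfl

/-- The exponential sum over `cellProd κ` twisted by a multiple of the phase is a product over
the blocks. -/
lemma sum_quarticChar_cellProd (c : ZMod 4) (z : Fin (2 * m) → ZMod 4) :
    ∑ x ∈ cellProd κ, quarticChar (c * totalPhase κ x) * quarticChar (∑ i, z i * x i) =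
      ∏ j, (cellSum (κ j) c (block z j) : ℂ) := by
  simp only [cellSum_coe]
  rw [← sum_prod_block, cellProd]
  refine Finset.sum_congr rfl fun x _ => ?_
  rw [← AddChar.map_add_eq_mul, dot_eq_sum_block, totalPhase, Finset.mul_sum,
    ← Finset.sum_add_distrib]
  exact map_prod quarticChar.toMonoidHom (fun j => Multiplicative.ofAdd _) _

lemma sum_dualEquiv_zero (z : Fin (2 * m) → ZMod 4) :
    ∑ s ∈ phaseGraph κ, dualEquiv m (0, z) s = ∏ j, (cellSum (κ j) 0 (block z j) : ℂ) := by
  rw [sum_phaseGraph, ← sum_quarticChar_cellProd]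
  simp [dualEquiv_apply]

lemma sum_dualEquiv_one (z : Fin (2 * m) → ZMod 4) :
    ∑ s ∈ phaseGraph κ, dualEquiv m (1, z) s =
      ((1 - Complex.I) * ∏ j, (cellSum (κ j) 1 (block z j) : ℂ) +
        (1 + Complex.I) * ∏ j, (cellSum (κ j) (-1) (block z j) : ℂ)) / 2 := by
  rw [sum_phaseGraph, ← sum_quarticChar_cellProd, ← sum_quarticChar_cellProd, Finset.mul_sum,
    Finset.mul_sum, ← Finset.sum_add_distrib, Finset.sum_div]
  refine Finset.sum_congr rfl fun x _ => ?_
  rw [dualEquiv_apply, one_mul, signChar_phaseClass, one_mul, neg_one_mul]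
  ring

lemma norm_sq_prod_coe (a : Fin m → GaussianInt) (n : Fin m → ℕ)
    (h : ∀ j, (a j).norm = 4 * n j) :
    Complex.normSq (∏ j, (a j : ℂ)) = 4 ^ m * ∏ j, (n j : ℝ) := by
  rw [map_prod]
  have : ∀ j, Complex.normSq (a j) = 4 * (n j : ℝ) := fun j => by
    rw [← GaussianInt.intCast_real_norm, h]; push_cast; rfl
  simp [this, Finset.prod_mul_distrib]

/-- If `A B̄` is real, the cross terms in `|(1 - i) A + (1 + i) B|²` cancel. -/
lemma normSq_combination {A B : ℂ} (h : (A * (starRingEnd ℂ) B).im = 0) :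
    Complex.normSq (((1 - Complex.I) * A + (1 + Complex.I) * B) / 2) =
      (Complex.normSq A + Complex.normSq B) / 2 := by
  simp only [Complex.mul_im, Complex.conj_re, Complex.conj_im] at h
  rw [Complex.normSq_div]
  simp only [Complex.normSq_apply, Complex.add_re, Complex.add_im, Complex.mul_re, Complex.mul_im,
    Complex.sub_re, Complex.sub_im, Complex.one_re, Complex.one_im, Complex.I_re, Complex.I_im,
    Complex.re_ofNat, Complex.im_ofNat]
  linear_combination h

lemma im_prod_coe_eq_zero (a b : Fin m → GaussianInt) (h : ∀ j, (a j * star (b j)).im = 0) :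
    ((∏ j, (a j : ℂ)) * (starRingEnd ℂ) (∏ j, (b j : ℂ))).im = 0 := by
  rw [map_prod, ← Finset.prod_mul_distrib]
  have : ∀ j, (a j : ℂ) * (starRingEnd ℂ) (b j : ℂ) = (((a j * star (b j)).re : ℝ) : ℂ) := by
    intro j
    rw [← GaussianInt.toComplex_star, ← map_mul, GaussianInt.toComplex_def (_ * _), h j,
      Int.cast_zero, zero_mul, add_zero, Complex.ofReal_intCast]
  rw [Finset.prod_congr rfl fun j _ => this j, ← Complex.ofReal_prod, Complex.ofReal_im]

lemma zero_mem_cellProd : (0 : Fin (2 * m) → ZMod 4) ∈ cellProd κ :=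
  mem_cellProd.2 fun _ => zero_mem_cellSet _

lemma totalPhase_zero : totalPhase κ 0 = 0 := by
  simp [totalPhase, block_zero, cellPhase_zero]

lemma zero_mem_phaseGraph : (0 : GroupZ m) ∈ phaseGraph κ :=
  mem_phaseGraph.2 ⟨zero_mem_cellProd, by rw [Prod.snd_zero, totalPhase_zero]; rfl⟩

lemma zero_mem_doubled : (0 : GroupZ m) ∈ doubled κ := zero_mk_mem_doubled.2 zero_mem_cellProd

variable (κ) in
lemma isFormallyDualPair_phaseGraph_doubled :
    IsFormallyDualPair (dualEquiv m) (phaseGraph κ) (doubled κ) := by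
  refine ⟨⟨0, zero_mem_phaseGraph⟩, ⟨0, zero_mem_doubled⟩, ?_⟩
  rintro ⟨w, z⟩
  rw [← Complex.normSq_eq_norm_sq, card_phaseGraph, card_doubled]
  have h4 : (4 : ℝ) ^ m ≠ 0 := by positivity
  have hw : w = 0 ∨ w = 1 := by revert w; decide
  rcases hw with rfl | rfl
  · rw [sum_dualEquiv_zero, norm_sq_prod_coe _ _ fun j => norm_cellSum_zero _ _,
      weightEnumerator_doubled_zero]
    push_cast
    field_simp
  · rw [sum_dualEquiv_one,
      normSq_combination (im_prod_coe_eq_zero _ _ fun j => cellSum_mul_star_im _ _),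
      norm_sq_prod_coe _ _ fun j => norm_cellSum_one _ _,
      norm_sq_prod_coe _ _ fun j => norm_cellSum_neg_one _ _, weightEnumerator_doubled_one]
    push_cast
    field_simp

/-! ### Primitivity -/

/-- The point of `ℤ₄^{2m}` whose `j`-th block is `d` and whose other blocks vanish. -/
def cellSingle (j : Fin m) (d : ZMod 4 × ZMod 4) : Fin (2 * m) → ZMod 4 :=
  (blockEquiv m).symm (Pi.single j d)

lemma block_cellSingle (j i : Fin m) (d : ZMod 4 × ZMod 4) :
    block (cellSingle j d) i = (Pi.single j d : Fin m → ZMod 4 × ZMod 4) i :=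
  block_blockEquiv_symm _ _

lemma block_cellSingle_same (j : Fin m) (d : ZMod 4 × ZMod 4) :
    block (cellSingle j d) j = d := by
  rw [block_cellSingle, Pi.single_eq_same]

lemma cellSingle_mem {j : Fin m} {d : ZMod 4 × ZMod 4} (hd : d ∈ cellSet (κ j)) :
    cellSingle j d ∈ cellProd κ := by
  refine mem_cellProd.2 fun i => ?_
  rw [block_cellSingle]
  rcases eq_or_ne i j with rfl | h
  · rwa [Pi.single_eq_same]
  · rw [Pi.single_eq_of_ne h]
    exact zero_mem_cellSet _

lemma totalPhase_cellSingle (j : Fin m) (d : ZMod 4 × ZMod 4) :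
    totalPhase κ (cellSingle j d) = cellPhase (κ j) d := by
  rw [totalPhase, Fintype.sum_eq_single j, block_cellSingle_same]
  intro i h
  rw [block_cellSingle, Pi.single_eq_of_ne h, cellPhase_zero]

lemma unit_mem_cellSet (b : Bool) :
    ∀ d ∈ ({(1, 0), (0, 1)} : Finset (ZMod 4 × ZMod 4)),
      d ∈ cellSet b ∧ phaseClass (cellPhase b d) = 0 := by
  revert b; decide +kernel

lemma exists_phaseClass_eq_one (b : Bool) :
    ∃ d ∈ cellSet b, phaseClass (cellPhase b d) = 1 := by
  revert b; decide +kernel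

lemma eq_top_of_units_mem {H : AddSubgroup (GroupZ m)}
    (h : ∀ j : Fin m, ∀ d ∈ ({(1, 0), (0, 1)} : Finset (ZMod 4 × ZMod 4)),
      ((0 : ZMod 2), cellSingle j d) ∈ H)
    {v : Fin (2 * m) → ZMod 4} (hv : ((1 : ZMod 2), v) ∈ H) : H = ⊤ := by
  let φ (j : Fin m) : ZMod 4 × ZMod 4 →+ GroupZ m :=
    (AddMonoidHom.inr _ _).comp
      ((blockEquiv m).symm.toAddMonoidHom.comp (AddMonoidHom.single (fun _ => ZMod 4 × ZMod 4) j))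
  have hφ : ∀ j d, φ j d ∈ H := by
    intro j d
    have hd : d = d.1.val • ((1, 0) : ZMod 4 × ZMod 4) + d.2.val • ((0, 1) : ZMod 4 × ZMod 4) := by
      revert d; decide
    rw [hd, map_add, map_nsmul, map_nsmul]
    exact H.add_mem (H.nsmul_mem (h j _ (by decide)) _) (H.nsmul_mem (h j _ (by decide)) _)
  have h0 : ∀ x : Fin (2 * m) → ZMod 4, ((0 : ZMod 2), x) ∈ H := by
    intro x
    have hx : ((0 : ZMod 2), x) = ∑ j, φ j (block x j) := by
      change _ = ∑ j, AddMonoidHom.inr (ZMod 2) _ ((blockEquiv m).symm (Pi.single j (block x j)))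
      rw [← map_sum, ← map_sum, Finset.univ_sum_single]
      exact congrArg (Prod.mk 0) ((blockEquiv m).symm_apply_apply x).symm
    rw [hx]
    exact H.sum_mem fun j _ => hφ j _
  refine (AddSubgroup.eq_top_iff' H).2 ?_
  rintro ⟨w, x⟩
  have hw : w = 0 ∨ w = 1 := by revert w; decide
  rcases hw with rfl | rfl
  · exact h0 x
  · have := H.add_mem hv (h0 (x - v))
    rwa [Prod.mk_add_mk, add_zero, add_sub_cancel] at this

lemma cellProd_no_period {z : Fin (2 * m) → ZMod 4}
    (h : ∀ x ∈ cellProd κ, z + x ∈ cellProd κ) : z = 0 := by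
  refine eq_zero_of_block fun j => cellSet_no_period (κ j) _ fun d hd => ?_
  have := mem_cellProd.1 (h _ (cellSingle_mem hd)) j
  rwa [block_add, block_cellSingle_same] at this

lemma isPrimitiveSubset_phaseGraph (hm : 0 < m) : IsPrimitiveSubset (phaseGraph κ) := by
  refine isPrimitiveSubset_of zero_mem_phaseGraph (fun H hH => ?_) ?_
  · obtain ⟨d, hd, hd1⟩ := exists_phaseClass_eq_one (κ ⟨0, hm⟩)
    refine eq_top_of_units_mem (v := cellSingle ⟨0, hm⟩ d)
      (fun j d hd => hH _ (mem_phaseGraph.2 ?_)) (hH _ (mem_phaseGraph.2 ⟨cellSingle_mem hd, ?_⟩))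
    · have := unit_mem_cellSet (κ j) d hd
      refine ⟨cellSingle_mem this.1, ?_⟩
      exact (by rw [totalPhase_cellSingle, this.2])
    · exact (by rw [totalPhase_cellSingle, hd1])
  · rintro ⟨w, z⟩ h
    have hz : z = 0 := cellProd_no_period (κ := κ) fun x hx =>
      (mem_phaseGraph.1 (h (phaseClass (totalPhase κ x), x) (mem_phaseGraph.2 ⟨hx, rfl⟩))).1
    subst hz
    have := (mem_phaseGraph.1 (h 0 zero_mem_phaseGraph)).2
    rw [add_zero, totalPhase_zero] at this
    exact Prod.ext this rfl

lemma isPrimitiveSubset_doubled (hm : 0 < m) : IsPrimitiveSubset (doubled κ) := by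
  refine isPrimitiveSubset_of zero_mem_doubled (fun H hH => ?_) ?_
  · refine eq_top_of_units_mem (v := 0) (fun j d hd => hH _ (zero_mk_mem_doubled.2 ?_))
      (hH _ (one_mk_mem_doubled.2 ?_))
    · exact cellSingle_mem (unit_mem_cellSet (κ j) d hd).1
    · rw [neg_zero]
      exact zero_mem_cellProd
  · rintro ⟨w, z⟩ h
    have hw : w = 0 ∨ w = 1 := by clear h; revert w; decide
    rcases hw with rfl | rfl
    · refine Prod.ext rfl (cellProd_no_period (κ := κ) fun x hx => zero_mk_mem_doubled.1 ?_)
      simpa using h (0, x) (zero_mk_mem_doubled.2 hx)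
    · -- A period `(1, z)` would exchange `X` and `-X`, which already fails in a single block.
      exfalso
      have h2 : (1 + 1 : ZMod 2) = 0 := rfl
      have h₁ : ∀ x ∈ cellProd κ, -(z + x) ∈ cellProd κ := fun x hx =>
        one_mk_mem_doubled.1 (by simpa using h (0, x) (zero_mk_mem_doubled.2 hx))
      have h₂ : ∀ x ∈ cellProd κ, z - x ∈ cellProd κ := fun x hx =>
        zero_mk_mem_doubled.1 (by
          have := h (1, -x) (one_mk_mem_doubled.2 (by rwa [neg_neg]))
          rwa [Prod.mk_add_mk, h2, ← sub_eq_add_neg] at this)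
      obtain ⟨d, hd, hd'⟩ := cellSet_no_swap (κ ⟨0, hm⟩) (block z ⟨0, hm⟩) fun d hd => by
        have := mem_cellProd.1 (h₁ _ (cellSingle_mem hd)) ⟨0, hm⟩
        rwa [block_neg, block_add, block_cellSingle_same] at this
      have := mem_cellProd.1 (h₂ _ (cellSingle_mem hd)) ⟨0, hm⟩
      rw [block_sub, block_cellSingle_same] at this
      exact hd' this

/-! ### Zeros of the difference spectrum -/

lemma card_forall_block (p : Fin m → ZMod 4 × ZMod 4 → Prop) [∀ j, DecidablePred (p j)] :
    (Finset.univ.filter fun z : Fin (2 * m) → ZMod 4 => ∀ j, p j (block z j)).card =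
      ∏ j, (Finset.univ.filter (p j)).card := by
  rw [← card_block_mem]
  simp only [Finset.mem_filter_univ]

/-- The zeros of `ν_T` for `T = doubled κ`, counted by inclusion and exclusion: `ν_T(0,z) ≠ 0` means
`z ∈ X - X`, and `ν_T(1,z) ≠ 0` means that `z` or `-z` lies in `X + X`. -/
lemma theta_doubled :
    theta (doubled κ) + (∏ j, (if κ j then 9 else 13) + 2 * ∏ j, (if κ j then 9 else 10)) =
      Fintype.card (GroupZ m) + ∏ j, (if κ j then 4 else 10) := by
  have hsplit := Finset.card_filter_add_card_filter_not (s := (Finset.univ : Finset (GroupZ m)))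
    fun y => weightEnumerator (doubled κ) y = 0
  have hnz : (Finset.univ.filter fun y => ¬ weightEnumerator (doubled κ) y = 0).card =
      (Finset.univ.filter fun z : Fin (2 * m) → ZMod 4 =>
        ∀ j, cellDiff (κ j) (block z j) ≠ 0).card +
      (Finset.univ.filter fun z : Fin (2 * m) → ZMod 4 =>
        (∀ j, cellAdd (κ j) (block z j) ≠ 0) ∨ ∀ j, cellAdd (κ j) (-block z j) ≠ 0).card := by
    have h01 : (Finset.univ : Finset (ZMod 2)) = {0, 1} := rfl
    rw [Finset.card_filter, Fintype.sum_prod_type, h01, Finset.sum_pair (by decide),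
      ← Finset.card_filter, ← Finset.card_filter]
    congr 2
    · ext z
      simp [weightEnumerator_doubled_zero, Finset.prod_eq_zero_iff]
    · ext z
      simp [weightEnumerator_doubled_one, Finset.prod_eq_zero_iff, imp_iff_not_or, or_comm]
  have hor := Finset.card_union_add_card_inter
    (Finset.univ.filter fun z : Fin (2 * m) → ZMod 4 => ∀ j, cellAdd (κ j) (block z j) ≠ 0)
    (Finset.univ.filter fun z : Fin (2 * m) → ZMod 4 => ∀ j, cellAdd (κ j) (-block z j) ≠ 0)
  rw [← Finset.filter_or, ← Finset.filter_and] at hor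
  simp only [← forall_and] at hor
  rw [card_forall_block fun j d => cellAdd (κ j) d ≠ 0 ∧ cellAdd (κ j) (-d) ≠ 0,
    card_forall_block fun j d => cellAdd (κ j) d ≠ 0,
    card_forall_block fun j d => cellAdd (κ j) (-d) ≠ 0] at hor
  rw [card_forall_block fun j d => cellDiff (κ j) d ≠ 0] at hnz
  simp only [card_cellAdd_ne_zero, card_cellAdd_neg_ne_zero, card_cellAdd_both_ne_zero,
    card_cellDiff_ne_zero] at hor hnz
  rw [hnz, ← theta_eq_card, Finset.card_univ] at hsplit
  omega

/-- The sequence of cells of the splitting with first part `k`: first `k` cells `J × J`, then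
cells `L`. -/
def splitKind (m k : ℕ) (j : Fin m) : Bool := decide (j.val < k)

lemma prod_splitKind {k l : ℕ} (h : k + l = m) (a b : ℕ) :
    ∏ j, (if splitKind m k j then a else b) = a ^ k * b ^ l := by
  subst h
  rw [Fin.prod_univ_add]
  simp [splitKind]

lemma theta_splitKind {k l : ℕ} (h : k + l = m) :
    theta (doubled (splitKind m k)) + (9 ^ k * 13 ^ l + 2 * (9 ^ k * 10 ^ l)) =
      Fintype.card (GroupZ m) + 4 ^ k * 10 ^ l := by
  have := theta_doubled (κ := splitKind m k)
  rwa [prod_splitKind h, prod_splitKind h, prod_splitKind h] at this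

lemma theta_splitKind_lt (hm : 2 ≤ m) {k : ℕ} (hk : k < m) :
    theta (doubled (splitKind m k)) < theta (doubled (splitKind m (k + 1))) := by
  obtain ⟨l, rfl⟩ : ∃ l, m = k + 1 + l := ⟨m - (k + 1), by omega⟩
  have h1 := theta_splitKind (m := k + 1 + l) (k := k) (l := l + 1) (by omega)
  have h2 := theta_splitKind (m := k + 1 + l) (k := k + 1) (l := l) rfl
  have hle : 4 ^ k * 10 ^ l ≤ 9 ^ k * 10 ^ l := by gcongr; norm_num
  -- This fails for `k = l = 0`, that is, for `m = 1`.
  have hlt : 4 ^ k * 10 ^ l < 9 ^ k * 13 ^ l := by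
    rcases Nat.eq_zero_or_pos k with rfl | hk0
    · have : 10 ^ l < 13 ^ l := Nat.pow_lt_pow_left (by norm_num) (by omega)
      simpa using this
    · exact Nat.mul_lt_mul_of_lt_of_le (Nat.pow_lt_pow_left (by norm_num) hk0.ne')
        (Nat.pow_le_pow_left (by norm_num) l) (by positivity)
  simp only [pow_succ] at h1 h2
  nlinarith [h1, h2, hle, hlt]

end CellProducts

/-! ### Identification of the pairs -/

lemma phaseClass_natCast (n : ℕ) :
    (phaseClass n = 0 ↔ n % 4 = 0 ∨ n % 4 = 1) ∧ (phaseClass n = 1 ↔ n % 4 = 2 ∨ n % 4 = 3) := by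
  rw [← ZMod.natCast_mod n 4]
  have : n % 4 < 4 := Nat.mod_lt _ (by norm_num)
  generalize n % 4 = r at this
  revert r
  decide

lemma two_mul_natCast (n : ℕ) :
    ((2 * n : ZMod 4) = 0 ↔ n % 2 = 0) ∧ ((2 * n : ZMod 4) = 2 ↔ n % 2 = 1) := by
  rcases Nat.even_or_odd' n with ⟨c, rfl | rfl⟩
  · have h : (2 * ((2 * c : ℕ) : ZMod 4)) = 0 := by
      push_cast
      rw [← mul_assoc, show (2 * 2 : ZMod 4) = 0 from rfl, zero_mul]
    rw [h]
    exact ⟨by simp, by simp; decide⟩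
  · have h : (2 * ((2 * c + 1 : ℕ) : ZMod 4)) = 2 := by
      push_cast
      rw [mul_add, ← mul_assoc, show (2 * 2 : ZMod 4) = 0 from rfl, zero_mul, zero_add, mul_one]
    rw [h]
    exact ⟨by simp; decide, by simp⟩

lemma forall_mem_setJ_iff {n : ℕ} (x : Fin n → ZMod 4) :
    (∀ i, x i ∈ setJ) ↔ wt 0 x + wt 1 x = n := by
  have hd : Disjoint (Finset.univ.filter fun i => x i = 0) (Finset.univ.filter fun i => x i = 1) :=
    Finset.disjoint_filter.2 fun i _ h0 h1 => by rw [h0] at h1; exact absurd h1 (by decide)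
  have h := Finset.card_filter_eq_iff (s := (Finset.univ : Finset (Fin n)))
    (p := fun i => x i = 0 ∨ x i = 1)
  rw [Finset.filter_or, Finset.card_union_of_disjoint hd, Finset.card_univ, Fintype.card_fin] at h
  rw [wt, wt, h]
  simp [setJ]

lemma sum_eq_wt_one {n : ℕ} {x : Fin n → ZMod 4} (h : ∀ i, x i ∈ setJ) :
    ∑ i, x i = (wt 1 x : ZMod 4) := by
  rw [wt, ← Finset.sum_boole]
  refine Finset.sum_congr rfl fun i _ => ?_
  have := h i
  revert this
  generalize x i = a
  revert a
  decide

lemma mem_biUnion_setB {n : ℕ} (p : ℕ → Prop) [DecidablePred p] (x : Fin (2 * n) → ZMod 4) :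
    x ∈ ((Finset.range (2 * n + 1)).filter p).biUnion (setB n) ↔
      (∀ i, x i ∈ setJ) ∧ p (wt 1 x) := by
  rw [forall_mem_setJ_iff]
  simp only [Finset.mem_biUnion, Finset.mem_filter, Finset.mem_range, setB, Finset.mem_univ,
    true_and]
  constructor
  · rintro ⟨i, ⟨hi, hp⟩, h0, rfl⟩
    exact ⟨by omega, hp⟩
  · rintro ⟨h, hp⟩
    exact ⟨_, ⟨by omega, hp⟩, by omega, rfl⟩

lemma mem_partJ0 {n : ℕ} {x : Fin (2 * n) → ZMod 4} :
    x ∈ partJ0 n ↔ (∀ i, x i ∈ setJ) ∧ phaseClass (∑ i, x i) = 0 := by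
  rw [partJ0, mem_biUnion_setB]
  refine and_congr_right fun h => ?_
  rw [sum_eq_wt_one h, (phaseClass_natCast _).1]

lemma mem_partJ1 {n : ℕ} {x : Fin (2 * n) → ZMod 4} :
    x ∈ partJ1 n ↔ (∀ i, x i ∈ setJ) ∧ phaseClass (∑ i, x i) = 1 := by
  rw [partJ1, mem_biUnion_setB]
  refine and_congr_right fun h => ?_
  rw [sum_eq_wt_one h, (phaseClass_natCast _).2]

lemma mem_setE {n i : ℕ} {x : Fin (2 * n) → ZMod 4} :
    x ∈ setE n i ↔ (∀ j, block x j ∈ setL) ∧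
      (Finset.univ.filter fun j => block x j ∈ setL1).card = i := by
  have hL : ∀ d : ZMod 4 × ZMod 4, (d ∈ setL1 → d ∈ setL) ∧ (d ∈ setL2 → d ∈ setL) ∧
      (d ∈ setL2 → d ∉ setL1) ∧ (d ∈ setL → d ∉ setL1 → d ∈ setL2) := by decide
  simp only [setE, Finset.mem_biUnion, Finset.mem_filter, Finset.mem_univ, true_and]
  constructor
  · rintro ⟨c, hc, h⟩
    have key : ∀ j, block x j ∈ setL ∧ (block x j ∈ setL1 ↔ c j = true) := fun j => by
      have hj := h j
      obtain ⟨h1, h2, h3, -⟩ := hL (block x j)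
      cases hcj : c j <;> simp only [hcj] at hj ⊢
      · exact ⟨h2 hj, by simpa using h3 hj⟩
      · exact ⟨h1 hj, by simpa using hj⟩
    refine ⟨fun j => (key j).1, ?_⟩
    simpa only [(key _).2] using hc
  · rintro ⟨h, hi⟩
    refine ⟨fun j => decide (block x j ∈ setL1), by simpa using hi, fun j => ?_⟩
    by_cases hj : block x j ∈ setL1
    · simp [hj]
    · simpa [hj] using (hL _).2.2.2 (h j) hj

lemma sum_cellPhase_false {n : ℕ} {x : Fin (2 * n) → ZMod 4} (h : ∀ j, block x j ∈ setL) :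
    ∑ j, cellPhase false (block x j) =
      2 * ((n - (Finset.univ.filter fun j => block x j ∈ setL1).card : ℕ) : ZMod 4) := by
  have hc := Finset.card_filter_add_card_filter_not (s := (Finset.univ : Finset (Fin n)))
    fun j => block x j ∈ setL1
  rw [Finset.card_univ, Fintype.card_fin] at hc
  rw [show n - (Finset.univ.filter fun j => block x j ∈ setL1).card =
    (Finset.univ.filter fun j => ¬ block x j ∈ setL1).card by omega, ← Finset.sum_boole,
    Finset.mul_sum]
  refine Finset.sum_congr rfl fun j _ => ?_
  have := h j
  revert this
  generalize block x j = d
  revert d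
  decide

lemma card_setL1_le {n : ℕ} (x : Fin (2 * n) → ZMod 4) :
    (Finset.univ.filter fun j => block x j ∈ setL1).card ≤ n :=
  (Finset.card_le_univ _).trans_eq (Fintype.card_fin n)

lemma mem_biUnion_setE {n : ℕ} (p : ℕ → Prop) [DecidablePred p] (x : Fin (2 * n) → ZMod 4) :
    x ∈ ((Finset.range (n + 1)).filter p).biUnion (setE n) ↔
      (∀ j, block x j ∈ setL) ∧ p (Finset.univ.filter fun j => block x j ∈ setL1).card := by
  simp only [Finset.mem_biUnion, Finset.mem_filter, Finset.mem_range, mem_setE]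
  constructor
  · rintro ⟨i, ⟨hi, hp⟩, h0, rfl⟩
    exact ⟨h0, hp⟩
  · rintro ⟨h, hp⟩
    exact ⟨_, ⟨Nat.lt_succ_of_le (card_setL1_le x), hp⟩,
      h, rfl⟩

lemma mem_partL0 {n : ℕ} {x : Fin (2 * n) → ZMod 4} :
    x ∈ partL0 n ↔ (∀ j, block x j ∈ setL) ∧ ∑ j, cellPhase false (block x j) = 0 := by
  rw [partL0, mem_biUnion_setE]
  refine and_congr_right fun h => ?_
  rw [sum_cellPhase_false h, (two_mul_natCast _).1]
  have := card_setL1_le x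
  omega

lemma mem_partL1 {n : ℕ} {x : Fin (2 * n) → ZMod 4} :
    x ∈ partL1 n ↔ (∀ j, block x j ∈ setL) ∧ ∑ j, cellPhase false (block x j) = 2 := by
  rw [partL1, mem_biUnion_setE]
  refine and_congr_right fun h => ?_
  rw [sum_cellPhase_false h, (two_mul_natCast _).2]
  have := card_setL1_le x
  omega

section Splitting

variable {m₁ m₂ : ℕ}

lemma block_leftPart (x : Fin (2 * (m₁ + m₂)) → ZMod 4) (j : Fin m₁) :
    block (leftPart rfl x) j = block x (Fin.castAdd m₂ j) := rfl

lemma block_rightPart (x : Fin (2 * (m₁ + m₂)) → ZMod 4) (j : Fin m₂) :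
    block (rightPart rfl x) j = block x (Fin.natAdd m₁ j) := by
  unfold block rightPart
  congr 2 <;> ext <;> simp <;> ring

lemma splitKind_castAdd (j : Fin m₁) : splitKind (m₁ + m₂) m₁ (Fin.castAdd m₂ j) = true := by
  simp [splitKind]

lemma splitKind_natAdd (j : Fin m₂) : splitKind (m₁ + m₂) m₁ (Fin.natAdd m₁ j) = false := by
  simp [splitKind]

lemma forall_mem_setJ_iff_block {n : ℕ} (x : Fin (2 * n) → ZMod 4) :
    (∀ i, x i ∈ setJ) ↔ ∀ j, block x j ∈ cellSet true := by
  rw [forall_coord_iff_forall_pairs]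
  simp only [cellSet, if_true, Finset.mem_product]
  rfl

lemma mem_cellProd_splitKind {x : Fin (2 * (m₁ + m₂)) → ZMod 4} :
    x ∈ cellProd (splitKind (m₁ + m₂) m₁) ↔
      (∀ i, leftPart rfl x i ∈ setJ) ∧ ∀ j, block (rightPart rfl x) j ∈ setL := by
  rw [mem_cellProd, Fin.forall_fin_add, forall_mem_setJ_iff_block]
  simp only [splitKind_castAdd, splitKind_natAdd, block_leftPart, block_rightPart]
  rfl

lemma totalPhase_splitKind (x : Fin (2 * (m₁ + m₂)) → ZMod 4) :
    totalPhase (splitKind (m₁ + m₂) m₁) x =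
      ∑ i, leftPart rfl x i + ∑ j, cellPhase false (block (rightPart rfl x) j) := by
  rw [totalPhase, Fin.sum_univ_add, sum_coord_eq_sum_pairs]
  simp only [splitKind_castAdd, splitKind_natAdd, block_rightPart]
  rfl

lemma mem_liftSet {m : ℕ} {A B : Finset (Fin (2 * m) → ZMod 4)} {g : GroupZ m} :
    g ∈ liftSet A B ↔ (g.1 = 0 ∧ g.2 ∈ A) ∨ (g.1 = 1 ∧ g.2 ∈ B) := by
  obtain ⟨w, x⟩ := g
  simp [liftSet, eq_comm, and_comm]

lemma prodSet_powJ_powL :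
    prodSet rfl (powJ m₁) (powL m₂) = cellProd (splitKind (m₁ + m₂) m₁) := by
  ext x
  simp only [prodSet, powJ, powL, Finset.mem_filter_univ, mem_cellProd_splitKind]

lemma mixT_eq {m : ℕ} (h : m₁ + m₂ = m) : mixT h = doubled (splitKind m m₁) := by
  subst h
  rw [mixT, doubled, prodSet_powJ_powL]
  congr 1
  ext x
  rw [Finset.mem_neg', ← prodSet_powJ_powL]
  simp only [prodSet, Finset.mem_filter_univ, Finset.mem_neg']
  rfl

lemma mixS_eq {m : ℕ} (h : m₁ + m₂ = m) : mixS h = phaseGraph (splitKind m m₁) := by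
  subst h
  ext ⟨w, x⟩
  simp only [mixS, mem_liftSet, mem_phaseGraph, mem_cellProd_splitKind, totalPhase_splitKind,
    Finset.mem_union, prodSet, Finset.mem_filter_univ, mem_partJ0, mem_partJ1, mem_partL0,
    mem_partL1]
  by_cases hL : ∀ j, block (rightPart rfl x) j ∈ setL
  · have ht : ∑ j, cellPhase false (block (rightPart rfl x) j) = 0 ∨
        ∑ j, cellPhase false (block (rightPart rfl x) j) = 2 := by
      rw [sum_cellPhase_false hL, (two_mul_natCast _).1, (two_mul_natCast _).2]
      exact Nat.mod_two_eq_zero_or_one _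
    have key : ∀ (w : ZMod 2) (s t : ZMod 4), t = 0 ∨ t = 2 →
        (w = phaseClass (s + t) ↔
          (w = 0 ∧ (phaseClass s = 0 ∧ t = 0 ∨ phaseClass s = 1 ∧ t = 2)) ∨
          (w = 1 ∧ (phaseClass s = 0 ∧ t = 2 ∨ phaseClass s = 1 ∧ t = 0))) := by decide +kernel
    rw [key _ _ _ ht]
    tauto
  · simp only [hL, false_and, and_false, or_self]

end Splitting

theorem mainTheorem1 (m : ℕ) (hm : 2 ≤ m) :
    ∃ (Δ : GroupZ m ≃+ AddChar (GroupZ m) ℂ) (S T : Fin (m + 1) → Finset (GroupZ m)),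
      -- `Δ` is the canonical isomorphism `(w, z) ↦ φ_{w,z}`
      (∀ y g : GroupZ m, Δ y g =
        (-1 : ℂ) ^ (y.1 * g.1).val * Complex.I ^ (∑ i, y.2 i * g.2 i).val) ∧
      -- the pairs are the explicit ones of the splittings `m = m₁ + m₂`, indexed by `m₁`
      (∀ (m₁ m₂ : ℕ) (h : m₁ + m₂ = m),
        S ⟨m₁, by omega⟩ = mixS h ∧ T ⟨m₁, by omega⟩ = mixT h) ∧
      (∀ k, IsPrimitiveFormallyDualPair Δ (S k) (T k)) ∧
      (∀ k, (S k).card ≠ (T k).card) ∧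
      (∀ k l, k ≠ l → ¬ PairEquivalent (S k) (T k) (S l) (T l)) ∧
      StrictMono (fun k => theta (T k)) ∧
      (∀ k, characterZeros (S k) = theta (T k)) ∧
      (∀ k l, k ≠ l → differenceSpectrum (T k) ≠ differenceSpectrum (T l)) ∧
      (∀ k l, k ≠ l → characterSpectrum (S k) ≠ characterSpectrum (S l)) := by
  have hm0 : 0 < m := by omega
  have hpos : 0 < 4 ^ m := by positivity
  have hcard : ∀ κ κ' : Fin m → Bool, (phaseGraph κ).card ≠ (doubled κ').card := fun κ κ' => by
    rw [card_phaseGraph, card_doubled]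
    omega
  have hmono : StrictMono fun k : Fin (m + 1) => theta (doubled (splitKind m k.val)) :=
    Fin.strictMono_iff_lt_succ.2 fun k => theta_splitKind_lt hm k.isLt
  have hdiff : ∀ k l : Fin (m + 1), k ≠ l →
      differenceSpectrum (doubled (splitKind m k.val)) ≠
        differenceSpectrum (doubled (splitKind m l.val)) := fun k l hkl h =>
    hkl (hmono.injective (congrArg (Multiset.count 0) h))
  have hzeros : ∀ κ : Fin m → Bool, characterZeros (phaseGraph κ) = theta (doubled κ) := fun κ =>
    (isFormallyDualPair_phaseGraph_doubled κ).characterZeros_eq_theta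
  have hchar : ∀ k l : Fin (m + 1), k ≠ l →
      characterSpectrum (phaseGraph (splitKind m k.val)) ≠
        characterSpectrum (phaseGraph (splitKind m l.val)) := fun k l hkl h => by
    refine hkl (hmono.injective ?_)
    simp only [← hzeros, characterZeros, h]
  refine ⟨dualEquiv m, fun k => phaseGraph (splitKind m k.val),
    fun k => doubled (splitKind m k.val), fun y g => rfl,
    fun m₁ m₂ h => ⟨(mixS_eq h).symm, (mixT_eq h).symm⟩,
    fun k => ⟨isFormallyDualPair_phaseGraph_doubled _, isPrimitiveSubset_phaseGraph hm0,
      isPrimitiveSubset_doubled hm0⟩,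
    fun k => hcard _ _, fun k l hkl => ?_, hmono, fun k => hzeros _, hdiff, hchar⟩
  rintro (h | h | h | h)
  · exact hchar k l hkl h.characterSpectrum_eq.symm
  · exact hcard _ _ h.card_eq.symm
  · exact hcard _ _ h.card_eq
  · exact hdiff k l hkl h.differenceSpectrum_eq.symm
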